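/- Let $p$ be a prime, $\Bbbk$ a field of characteristic $p$, $V$ a finite-dimensional $\Bbbk$-vector space and $G\subseteq \mathrm{GL}(V)$ a finite $p$-group. Let $G$ act on $V^*$ by $(gx)(v)=x(g^{-1}v)$, extend this to an action by $\Bbbk$-algebra automorphisms on $S=\operatorname{Sym}V^*$, and let $S^G$ be the ring of invariants. For an ordered basis $x_1,\dots,x_n$ of $V^*$ and $g\in G$, let $\beta_g$ be the largest $j$ such that $x_j$ appears with nonzero coefficient in $gx_i-x_i$ for some $i$ (with $\beta_g=0$ if there is no such $j$). The group $G$ is called a generalised Nakajima group if there are an ordered basis $x_1,\dots,x_n$ of $V^*$ and integers $1\le i_0<i_1<\dots<i_r\le n$ ($r<n$) such that (1) $gx_i-x_i\in\Bbbk\langle x_1,\dots,x_{i-1}\rangle$ for all $g\in G$ and $1\le i\le n$; and (2) $G$ is generated by $P_1\cup\dots\cup P_r$, where $P_k$ is the subgroup generated by all $g\in G$ such that, for every $i$, if $gx_i\ne x_i$ then $i_{k-1}<i\le i_k$ and $\beta_g\le i_{k-1}$. Suppose that $G$ is a generalised Nakajima group and that $S^G$ is a direct summand of $S$ as an $S^G$-module.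 Then $S^G$ is a polynomial ring over $\Bbbk$, that is, $S^G$ is isomorphic as a $\Bbbk$-algebra to a polynomial ring over $\Bbbk$ in $n=\dim_\Bbbk V$ variables. -/

import Mathlib

namespace GenNakajima

open Module

noncomputable section

universe u v

variable {k : Type u} [Field k] {V : Type v} [AddCommGroup V] [Module k V]

/-- The action of `g ∈ GL(V)` on `V^*`, namely `(g x)(v) = x (g⁻¹ v)`. -/
def dualAct (g : LinearMap.GeneralLinearGroup k V) : Dual k V →ₗ[k] Dual k V :=
  ((g⁻¹ : LinearMap.GeneralLinearGroup k V) : V →ₗ[k] V).dualMap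

/-- The action of `g ∈ GL(V)` on `S = Sym V^*` by `k`-algebra maps, extending `dualAct g`. -/
def symAct (g : LinearMap.GeneralLinearGroup k V) :
    SymmetricAlgebra k (Dual k V) →ₐ[k] SymmetricAlgebra k (Dual k V) :=
  SymmetricAlgebra.lift (SymmetricAlgebra.ι k (Dual k V) ∘ₗ dualAct g)

/-- The ring of invariants `S^G`, a `k`-subalgebra of `S = Sym V^*`. -/
def invariants (G : Subgroup (LinearMap.GeneralLinearGroup k V)) :
    Subalgebra k (SymmetricAlgebra k (Dual k V)) where
  carrier := {f | ∀ g ∈ G, symAct g f = f}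
  mul_mem' ha hb g hg := by rw [map_mul, ha g hg, hb g hg]
  add_mem' ha hb g hg := by rw [map_add, ha g hg, hb g hg]
  algebraMap_mem' r g _ := AlgHom.commutes _ r

open scoped Classical in
/-- `β_g = max {j | x_j appears in g x_i - x_i for some i}`, with positions counted from `1`
(the vector `b j` is `x_{j+1}`); it is `0` if `g` fixes every `x_i`. -/
def beta {n : ℕ} (b : Basis (Fin n) k (Dual k V)) (g : LinearMap.GeneralLinearGroup k V) : ℕ :=
  (Finset.univ.filter fun j : Fin n => ∃ i : Fin n, b.repr (dualAct g (b i) - b i) j ≠ 0).sup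
    fun j => (j : ℕ) + 1

/-- The subgroup of `G` generated by all `g ∈ G` such that `g x_i ≠ x_i` implies
`l < i ≤ m` and `β_g ≤ l` (positions `i` counted from `1`). -/
def blockSubgroup (G : Subgroup (LinearMap.GeneralLinearGroup k V)) {n : ℕ}
    (b : Basis (Fin n) k (Dual k V)) (l m : ℕ) : Subgroup (LinearMap.GeneralLinearGroup k V) :=
  Subgroup.closure {g | g ∈ G ∧ ∀ i : Fin n, dualAct g (b i) ≠ b i →
    (l < (i : ℕ) + 1 ∧ (i : ℕ) + 1 ≤ m) ∧ beta b g ≤ l}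

/-- `G` is a generalised Nakajima group: there are an ordered basis `x_1, …, x_n` of `V^*` and
integers `1 ≤ s 0 < s 1 < ⋯ < s r ≤ n` (`r < n`) such that every `g ∈ G` satisfies
`g x_i - x_i ∈ ⟨x_1, …, x_{i-1}⟩` for all `i`, and `G` is generated by `P_1 ∪ ⋯ ∪ P_r`, where
`P_{t+1} = blockSubgroup G b (s t) (s (t+1))`. -/
def IsGenNakajima (G : Subgroup (LinearMap.GeneralLinearGroup k V)) : Prop :=
  ∃ (n : ℕ) (b : Basis (Fin n) k (Dual k V)) (r : ℕ) (s : Fin (r + 1) → ℕ),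
    r < n ∧ 1 ≤ s 0 ∧ StrictMono s ∧ s (Fin.last r) ≤ n ∧
    (∀ g ∈ G, ∀ i : Fin n, dualAct g (b i) - b i ∈ Submodule.span k (b '' {j | j < i})) ∧
    Subgroup.closure
      (⋃ t : Fin r, (blockSubgroup G b (s t.castSucc) (s t.succ) :
        Set (LinearMap.GeneralLinearGroup k V))) = G

/-- The subring `A` of `S` is a direct summand of `S` as an `A`-module. -/
def IsDirectSummand {S : Type*} [CommRing S] [Algebra k S] (A : Subalgebra k S) : Prop :=
  ∃ N : Submodule A S, IsCompl (LinearMap.range (Algebra.linearMap A S)) N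

end

end GenNakajima

/-!
Let `S = k[x₁, …, xₙ]` be `Sym V^*` in the given coordinates, `S^G` the ring of invariants and `H`
the Hilbert ideal, generated in `S` by the invariants without constant term. The theorem rests on
the fact that `H` is generated by `n` elements.

The generators of `G` respect a partition of the variables into blocks: each of them changes the
variables of one block only, by linear forms in the variables of lower blocks. Two consequences are
used. The coefficients of an invariant with respect to its top block of variables are again
invariant (`coeff_expandBlock_mem_fixedSubalgebra`), and translations of the top block commute with
the group (`coeff_translateBlock_mem_fixedSubalgebra`). Going up block by block, they show that `H`
is a coideal for the coproduct `xᵢ ↦ xᵢ ⊗ 1 + 1 ⊗ xᵢ`, that is, `S ⧸ H` inherits the coproduct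
(`coproductMod_eq_algebraMap`).

A proper coideal `J` of `S` is generated by at most `n` elements, over any field
(`exists_generators_of_coideal`). Indeed, the standard monomials of `J` are a basis of `S ⧸ J`. If
`β + γ` is a minimal exponent of the initial ideal, with `β` and `γ` nonzero of disjoint supports,
then the coproduct of `x^(β + γ)` contains `x^β ⊗ x^γ` with coefficient `1`, while its reduction to
standard monomials cannot produce that term. So the initial ideal is generated by powers of
variables (`exists_single_of_minimal`), hence by at most `n` monomials.

Homogeneous invariants that form a basis of `H ⧸ S₊H` are therefore at most `n` in number. If `S^G`
is a direct summand of `S`, a retraction `S → S^G` turns a relation `b = ∑ xᵢ aᵢ` with coefficients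
in `S` into one with coefficients in `S^G`, so by induction on the degree these invariants generate
the algebra `S^G` (`exists_algebra_generators`). As `S` is integral over `S^G`, the transcendence
degree of `S^G` is `n`, so the generators are `n` algebraically independent elements
(`nonempty_algEquiv_of_generators`).
-/

namespace GenNakajima

open MvPolynomial

/-! ### Coideals of a polynomial ring -/

section Coproduct

open TensorProduct

variable {σ k : Type*} [Field k] {Q : Type*} [CommRing Q] [Algebra k Q]

/-- The coproduct `X i ↦ X i ⊗ 1 + 1 ⊗ X i` of the polynomial ring `S`, followed by `π ⊗ π`. For `π`
a quotient map with kernel `J`, it kills `J` exactly when the coproduct maps `J` into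
`J ⊗ S + S ⊗ J`; such an ideal is called a coideal below, without a condition on constant terms.
The target `Q` is an arbitrary algebra rather than a quotient ring only for the sake of instance
search. -/
noncomputable def coproductMod (π : MvPolynomial σ k →ₐ[k] Q) : MvPolynomial σ k →ₐ[k] Q ⊗[k] Q :=
  aeval fun i => π (X i) ⊗ₜ 1 + 1 ⊗ₜ π (X i)

lemma coproductMod_X (π : MvPolynomial σ k →ₐ[k] Q) (i : σ) :
    coproductMod π (X i) = π (X i) ⊗ₜ 1 + 1 ⊗ₜ π (X i) :=
  aeval_X _ i

lemma coproductMod_monomial [Fintype σ] [DecidableEq σ] (π : MvPolynomial σ k →ₐ[k] Q)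
    (c : σ →₀ ℕ) :
    coproductMod π (monomial c 1) = ∑ d ∈ Fintype.piFinset fun i => Finset.range (c i + 1),
      (∏ i, (c i).choose (d i) : ℕ) • (π
        (monomial (Finsupp.equivFunOnFinite.symm d) 1) ⊗ₜ[k] π
        (monomial (c - Finsupp.equivFunOnFinite.symm d) 1)) := by
  have hmon : ∀ e : σ →₀ ℕ, (monomial e 1 : MvPolynomial σ k) = ∏ i, X i ^ e i := by
    intro e
    rw [monomial_eq, map_one, one_mul, Finsupp.prod_fintype _ _ (by simp)]
  have htprod : ∀ f g : σ → Q,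
      (∏ i, f i) ⊗ₜ[k] (∏ i, g i) = ∏ i, f i ⊗ₜ[k] g i := by
    intro f g
    induction (Finset.univ : Finset σ) using Finset.induction_on with
    | empty => rfl
    | insert a s ha ih => simp [Finset.prod_insert ha, ← ih]
  rw [hmon, map_prod]
  simp only [map_pow, coproductMod_X, add_pow, Finset.prod_univ_sum]
  refine Finset.sum_congr rfl fun d _ => ?_
  rw [Finset.prod_mul_distrib, ← Nat.cast_prod, mul_comm, ← nsmul_eq_mul]
  congr 1
  simp only [hmon, map_prod, htprod]
  refine Finset.prod_congr rfl fun i _ => ?_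
  simp

end Coproduct

section Coideal

open TensorProduct

variable {σ k : Type*} [Field k] (m : MonomialOrder σ) (J : Ideal (MvPolynomial σ k))
  {Q : Type*} [CommRing Q] [Algebra k Q] (π : MvPolynomial σ k →ₐ[k] Q)

/-- The exponents of the initial ideal of `J`: those divisible by the leading exponent of a nonzero
element of `J`. The remaining exponents are those of the standard monomials. -/
def initialExponents : Set (σ →₀ ℕ) :=
  {c | ∃ f ∈ J, f ≠ 0 ∧ m.degree f ≤ c}

variable {m J}

lemma degree_mem_initialExponents {f : MvPolynomial σ k} (hf : f ∈ J) (h0 : f ≠ 0) :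
    m.degree f ∈ initialExponents m J :=
  ⟨f, hf, h0, le_rfl⟩

lemma initialExponents_mono {c d : σ →₀ ℕ} (hcd : c ≤ d) (hc : c ∈ initialExponents m J) :
    d ∈ initialExponents m J := by
  obtain ⟨f, hf, h0, h⟩ := hc
  exact ⟨f, hf, h0, h.trans hcd⟩

variable (m) in
lemma linearIndependent_standard (hπ : ∀ f, π f = 0 → f ∈ J) :
    LinearIndependent k fun c : {c : σ →₀ ℕ // c ∉ initialExponents m J} =>
      π (monomial c.1 1) := by
  classical
  rw [linearIndependent_iff]
  intro l hl
  set f : MvPolynomial σ k := Finsupp.linearCombination k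
    (fun c : {c : σ →₀ ℕ // c ∉ initialExponents m J} => (monomial c.1 1 : MvPolynomial σ k)) l
    with hf
  have hcoeff : ∀ c, coeff c.1 f = l c := by
    intro c
    rw [hf, Finsupp.linearCombination_apply, Finsupp.sum, coeff_sum]
    simp only [coeff_smul, coeff_monomial, smul_eq_mul, mul_ite, mul_one, mul_zero,
      Subtype.coe_inj]
    rw [Finset.sum_ite_eq' l.support c]
    simp +contextual [eq_comm]
  have hsupp : ∀ c ∈ f.support, c ∉ initialExponents m J := by
    intro c hc hcJ
    rw [mem_support_iff] at hc
    apply hc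
    rw [hf, Finsupp.linearCombination_apply, Finsupp.sum, coeff_sum]
    refine Finset.sum_eq_zero fun d _ => ?_
    rw [coeff_smul, coeff_monomial, if_neg, smul_zero]
    rintro rfl
    exact d.2 hcJ
  have hfJ : f ∈ J := by
    apply hπ
    rw [← hl, hf, Finsupp.linearCombination_apply,
      Finsupp.linearCombination_apply, Finsupp.sum, Finsupp.sum, map_sum]
    simp only [map_smul]
  have hf0 : f = 0 := by
    by_contra h0
    exact hsupp _ (m.degree_mem_support h0) (degree_mem_initialExponents hfJ h0)
  ext c
  rw [← hcoeff c, hf0]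
  simp

variable (m) in
open scoped Classical in
/-- Each standard monomial of `J` is picked out by a linear form on a ring to which `S` maps with
kernel in `J`. -/
lemma exists_dual_standard (hπ : ∀ f, π f = 0 → f ∈ J) {b : σ →₀ ℕ}
    (hb : b ∉ initialExponents m J) :
    ∃ u : Q →ₗ[k] k, ∀ c, c ∉ initialExponents m J →
      u (π (monomial c 1)) = if c = b then 1 else 0 := by
  have hv := linearIndependent_standard m π hπ
  obtain ⟨u, hu⟩ := LinearMap.exists_extend (Finsupp.lapply (R := k) ⟨b, hb⟩ ∘ₗ hv.repr)
  refine ⟨u, fun c hc => ?_⟩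
  have h1 := LinearMap.congr_fun hu ⟨_, Submodule.subset_span (Set.mem_range_self ⟨c, hc⟩)⟩
  simp only [LinearMap.comp_apply, Submodule.subtype_apply] at h1
  rw [h1]
  have h2 := hv.repr_eq_single ⟨c, hc⟩ ⟨_, Submodule.subset_span (Set.mem_range_self ⟨c, hc⟩)⟩ rfl
  rw [h2]
  simp [Finsupp.single_apply]

/-- The initial ideal of a coideal is generated by powers of variables. If `α = β + γ` is a minimal
exponent of it and `β`, `γ` are nonzero with disjoint supports, then `x^α` is congruent modulo `J`
to a combination of standard monomials; comparing the coefficients of `x^β ⊗ x^γ` in the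
coproduct of the difference gives `1 = 0`. -/
lemma exists_single_of_minimal [Fintype σ] (hπ : ∀ f, π f = 0 → f ∈ J)
    (hΔ : ∀ f ∈ J, coproductMod π f = 0)
    {α : σ →₀ ℕ} (hα : Minimal (· ∈ initialExponents m J) α) (hα0 : α ≠ 0) :
    ∃ i, α = Finsupp.single i (α i) := by
  classical
  obtain ⟨i, hi⟩ := Finsupp.ne_iff.mp hα0
  rw [Finsupp.zero_apply] at hi
  refine ⟨i, ?_⟩
  by_contra hne
  set β : σ →₀ ℕ := Finsupp.single i (α i) with hβ
  have hβα : β ≤ α := by rw [hβ, Finsupp.single_le_iff]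
  set γ : σ →₀ ℕ := α - β with hγ
  have hsum : β + γ = α := add_tsub_cancel_of_le hβα
  have hβ0 : β ≠ 0 := by simp [hβ, hi]
  have hγ0 : γ ≠ 0 := by
    intro h
    rw [h, add_zero] at hsum
    exact hne hsum.symm
  have hstd : ∀ c ≤ α, c ≠ α → c ∉ initialExponents m J := fun c hc hcα hcJ =>
    hcα (le_antisymm hc (hα.2 hcJ hc))
  have hβs : β ∉ initialExponents m J := hstd β hβα fun h => hγ0 (by simpa [h] using hsum)
  have hγs : γ ∉ initialExponents m J :=
    hstd γ (hγ ▸ tsub_le_self) fun h => hβ0 (by simpa [h] using hsum)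
  have h0s : (0 : σ →₀ ℕ) ∉ initialExponents m J := hstd 0 (zero_le) hα0.symm
  obtain ⟨u, hu⟩ := exists_dual_standard m π hπ hβs
  obtain ⟨v, hv⟩ := exists_dual_standard m π hπ hγs
  set φ : Q ⊗[k] Q →ₗ[k] k :=
    LinearMap.mul' k k ∘ₗ TensorProduct.map u v with hφ
  have hφt : ∀ a b, φ (a ⊗ₜ b) = u a * v b := fun a b => by simp [hφ]
  -- `φ` reads off the coefficient of `x^β ⊗ x^γ`.
  have key : ∀ c, (c ∉ initialExponents m J ∨ c = α) →
      φ (coproductMod π (monomial c 1)) = if c = α then 1 else 0 := by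
    intro c hc
    have hterm : ∀ a b : σ →₀ ℕ, a + b = c →
        u (π (monomial a 1)) * v (π (monomial b 1)) =
          if a = β ∧ b = γ then 1 else 0 := by
      intro a b hab
      have hac : a ≤ c := hab ▸ le_self_add
      have hbc : b ≤ c := hab ▸ le_add_self
      -- A factor is nonstandard only in the terms `x^α ⊗ 1` and `1 ⊗ x^α`, which do not contribute
      -- as `β` and `γ` are nonzero.
      by_cases ha : a ∈ initialExponents m J
      · have haα : a = α := by
          rcases hc with hc | rfl
          · exact absurd (initialExponents_mono hac ha) hc
          · by_contra h
            exact hstd a hac h ha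
        have hcα : c = α := by
          rcases hc with hc | rfl
          · exact absurd (initialExponents_mono hac ha) hc
          · rfl
        have hb0 : b = 0 := by simpa [haα, hcα] using hab
        rw [hb0, hv 0 h0s, if_neg hγ0.symm, mul_zero, if_neg]
        rintro ⟨-, h⟩
        exact hγ0 h.symm
      · by_cases hb : b ∈ initialExponents m J
        · have hbα : b = α := by
            rcases hc with hc | rfl
            · exact absurd (initialExponents_mono hbc hb) hc
            · by_contra h
              exact hstd b hbc h hb
          have hcα : c = α := by
            rcases hc with hc | rfl
            · exact absurd (initialExponents_mono hbc hb) hc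
            · rfl
          have ha0 : a = 0 := by simpa [hbα, hcα] using hab
          rw [ha0, hu 0 h0s, if_neg hβ0.symm, zero_mul, if_neg]
          rintro ⟨h, -⟩
          exact hβ0 h.symm
        · rw [hu a ha, hv b hb]
          by_cases h1 : a = β <;> by_cases h2 : b = γ <;> simp [h1, h2]
    rw [coproductMod_monomial, map_sum]
    have hle : ∀ d ∈ Fintype.piFinset fun i => Finset.range (c i + 1),
        Finsupp.equivFunOnFinite.symm d ≤ c := by
      intro d hd j
      simp only [Fintype.mem_piFinset, Finset.mem_range] at hd
      simpa using Nat.lt_succ_iff.mp (hd j)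
    have hrw : ∀ d ∈ Fintype.piFinset fun i => Finset.range (c i + 1),
        φ ((∏ i, (c i).choose (d i) : ℕ) • (π
          (monomial (Finsupp.equivFunOnFinite.symm d) 1) ⊗ₜ[k] π
          (monomial (c - Finsupp.equivFunOnFinite.symm d) 1))) =
        if d = β then (if c = α then 1 else 0) else 0 := by
      intro d hd
      rw [map_nsmul, hφt, hterm _ _ (add_tsub_cancel_of_le (hle d hd))]
      by_cases h1 : d = β
      · have hdβ : Finsupp.equivFunOnFinite.symm d = β := by ext j; simp [h1]
        have hβc : β ≤ c := hdβ ▸ hle d hd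
        rw [if_pos h1, hdβ]
        by_cases h2 : c = α
        · subst h2
          rw [if_pos ⟨rfl, rfl⟩, if_pos rfl]
          rw [Finset.prod_eq_one, one_smul]
          intro j _
          by_cases hj : j = i
          · subst hj; simp [h1, hβ]
          · simp [h1, hβ, Ne.symm hj]
        · rw [if_neg h2, if_neg, smul_zero]
          rintro ⟨-, h⟩
          apply h2
          rw [← hsum, ← h, add_tsub_cancel_of_le hβc]
      · rw [if_neg h1, if_neg, smul_zero]
        rintro ⟨h, -⟩
        apply h1
        rw [← h]
        rfl
    rw [Finset.sum_congr rfl hrw, Finset.sum_ite_eq']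
    split_ifs with h1 h2 h2 <;> try rfl
    exfalso
    apply h1
    rw [h2]
    simpa [Fintype.mem_piFinset, Nat.lt_succ_iff] using fun j => hβα j
  obtain ⟨g, r, hfr, -, hr⟩ := m.div_set (B := {f | f ∈ J ∧ f ≠ 0})
    (fun b hb => (m.leadingCoeff_ne_zero_iff.mpr hb.2).isUnit) (monomial α (1 : k))
  have hrs : ∀ c ∈ r.support, c ∉ initialExponents m J := by
    rintro c hc ⟨f, hf, hf0, hfc⟩
    exact hr c hc f ⟨hf, hf0⟩ hfc
  have hmem : monomial α 1 - r ∈ J := by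
    rw [hfr, add_sub_cancel_right, Finsupp.linearCombination_apply, Finsupp.sum]
    exact J.sum_mem fun b _ => J.mul_mem_left _ b.2.1
  have h0 := congrArg φ (hΔ _ hmem)
  rw [map_sub, map_sub, key α (Or.inr rfl), if_pos rfl, map_zero] at h0
  have hr0 : φ (coproductMod π r) = 0 := by
    conv_lhs => rw [r.as_sum]
    rw [map_sum, map_sum]
    refine Finset.sum_eq_zero fun c hc => ?_
    have : (monomial c (coeff c r)) = coeff c r • (monomial c 1 : MvPolynomial σ k) := by
      rw [smul_monomial, smul_eq_mul, mul_one]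
    rw [this, map_smul, map_smul, key c (Or.inl (hrs c hc)), if_neg, smul_zero]
    rintro rfl
    exact hrs _ hc hα.1
  rw [hr0, sub_zero] at h0
  exact one_ne_zero h0

/-- A proper coideal of a polynomial ring is generated by at most as many elements as there are
variables: for each variable a power of which is a leading monomial, one element with the lowest
such leading monomial. -/
theorem exists_generators_of_coideal [Fintype σ] (J : Ideal (MvPolynomial σ k)) (hJ : J ≠ ⊤)
    (hπ : ∀ f, π f = 0 → f ∈ J) (hΔ : ∀ f ∈ J, coproductMod π f = 0) :
    ∃ h : σ → MvPolynomial σ k, Ideal.span (Set.range h) = J := by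
  classical
  obtain ⟨m⟩ : Nonempty (MonomialOrder σ) := by
    let _ : LinearOrder σ := linearOrderOfSTO (WellOrderingRel (α := σ))
    exact ⟨MonomialOrder.lex⟩
  -- The generator attached to a variable is `0` if no power of it is a leading monomial.
  have hchoice : ∀ i, ∃ h ∈ J, ∀ f ∈ J, f ≠ 0 → ∀ a, m.degree f = Finsupp.single i a →
      h ≠ 0 ∧ m.degree h ≤ m.degree f := by
    intro i
    by_cases hex : ∃ a, ∃ f ∈ J, f ≠ 0 ∧ m.degree f = Finsupp.single i a
    · obtain ⟨h, hhJ, hh0, hh⟩ := Nat.find_spec hex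
      refine ⟨h, hhJ, fun f hf hf0 a ha => ⟨hh0, ?_⟩⟩
      rw [hh, ha, Finsupp.single_le_iff, Finsupp.single_eq_same]
      exact Nat.find_min' hex ⟨f, hf, hf0, ha⟩
    · exact ⟨0, J.zero_mem, fun f hf hf0 a ha => absurd ⟨a, f, hf, hf0, ha⟩ hex⟩
  choose h hhJ hh using hchoice
  refine ⟨h, le_antisymm (Ideal.span_le.mpr (by rintro _ ⟨i, rfl⟩; exact hhJ i)) fun f hf => ?_⟩
  obtain ⟨g, r, hfr, -, hr⟩ := m.div_set (B := {f | f ∈ Set.range h ∧ f ≠ 0})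
    (fun b hb => (m.leadingCoeff_ne_zero_iff.mpr hb.2).isUnit) f
  have hlin : Finsupp.linearCombination _
      (fun b : {f | f ∈ Set.range h ∧ f ≠ 0} => (b : MvPolynomial σ k)) g ∈
      Ideal.span (Set.range h) := by
    rw [Finsupp.linearCombination_apply, Finsupp.sum]
    exact Ideal.sum_mem _ fun b _ => Ideal.mul_mem_left _ _ (Ideal.subset_span b.2.1)
  have hle : Ideal.span (Set.range h) ≤ J :=
    Ideal.span_le.mpr (by rintro _ ⟨i, rfl⟩; exact hhJ i)
  have hrJ : r ∈ J := by
    have : r = f - _ := (sub_eq_of_eq_add' hfr).symm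
    rw [this]
    exact J.sub_mem hf (hle hlin)
  have hr0 : r = 0 := by
    by_contra hr0
    obtain ⟨α, hαle, hα⟩ := exists_minimal_le_of_wellFoundedLT (· ∈ initialExponents m J) _
      (degree_mem_initialExponents hrJ hr0)
    obtain ⟨f', hf', hf0', hfα⟩ := hα.1
    have hf'α : m.degree f' = α :=
      le_antisymm hfα (hα.2 (degree_mem_initialExponents hf' hf0') hfα)
    by_cases hα0 : α = 0
    · apply hJ
      rw [hα0] at hf'α
      have hC := m.eq_C_of_degree_eq_zero hf'α
      refine Ideal.eq_top_of_isUnit_mem _ hf' ?_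
      rw [hC]
      exact (m.leadingCoeff_ne_zero_iff.mpr hf0').isUnit.map C
    · obtain ⟨i, hi⟩ := exists_single_of_minimal π hπ hΔ hα hα0
      obtain ⟨h1, h2⟩ := hh i f' hf' hf0' _ (hf'α.trans hi)
      exact hr _ (m.degree_mem_support hr0) (h i) ⟨⟨i, rfl⟩, h1⟩
        ((h2.trans hf'α.le).trans hαle)
  rw [hfr, hr0, add_zero]
  exact hlin

end Coideal

/-! ### The Hilbert ideal of a blockwise unitriangular action -/

section HilbertIdeal

open TensorProduct

variable {σ k : Type*} [Field k]

/-- The subalgebra of the polynomials fixed by every member of a set of endomorphisms. -/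
noncomputable def fixedSubalgebra (Γ : Set (MvPolynomial σ k →ₐ[k] MvPolynomial σ k)) :
    Subalgebra k (MvPolynomial σ k) where
  carrier := {f | ∀ φ ∈ Γ, φ f = f}
  mul_mem' ha hb φ hφ := by rw [map_mul, ha φ hφ, hb φ hφ]
  add_mem' ha hb φ hφ := by rw [map_add, ha φ hφ, hb φ hφ]
  algebraMap_mem' r φ _ := φ.commutes r

/-- The Hilbert ideal of a subalgebra `A` of the polynomial ring: the ideal of the whole ring
generated by the elements of `A` without constant term. -/
noncomputable def hilbertIdeal (A : Subalgebra k (MvPolynomial σ k)) : Ideal (MvPolynomial σ k) :=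
  Ideal.span {f | f ∈ A ∧ constantCoeff f = 0}

lemma hilbertIdeal_le_ker (A : Subalgebra k (MvPolynomial σ k)) :
    hilbertIdeal A ≤ RingHom.ker (constantCoeff (R := k) (σ := σ)) :=
  Ideal.span_le.mpr fun _ hf => hf.2

lemma hilbertIdeal_ne_top (A : Subalgebra k (MvPolynomial σ k)) : hilbertIdeal A ≠ ⊤ := by
  intro h
  have : (1 : MvPolynomial σ k) ∈ hilbertIdeal A := h ▸ Submodule.mem_top
  simpa using hilbertIdeal_le_ker A this

/-- The variables come in blocks given by `bl`, and each member of `Γ` changes the variables of just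
one block, adding to them polynomials in the variables of the lower blocks; linearity of these
polynomials plays no role for the Hilbert ideal. -/
def IsBlockwise (bl : σ → ℕ) (Γ : Set (MvPolynomial σ k →ₐ[k] MvPolynomial σ k)) : Prop :=
  ∀ φ ∈ Γ, ∃ l, ∀ i, (bl i ≠ l → φ (X i) = X i) ∧
    (bl i = l → φ (X i) - X i ∈ supported k {j | bl j < l})

variable {bl : σ → ℕ} {Γ : Set (MvPolynomial σ k →ₐ[k] MvPolynomial σ k)}

/-- Two algebra homomorphisms agree on a supported polynomial if they agree on its variables. -/
lemma eq_of_mem_supported {B : Type*} [CommRing B] [Algebra k B] {F G : MvPolynomial σ k →ₐ[k] B}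
    {s : Set σ} (h : ∀ i ∈ s, F (X i) = G (X i)) {f : MvPolynomial σ k} (hf : f ∈ supported k s) :
    F f = G f := by
  rw [supported_eq_adjoin_X] at hf
  have : Algebra.adjoin k (X '' s) ≤ AlgHom.equalizer F G :=
    Algebra.adjoin_le (by rintro _ ⟨i, hi, rfl⟩; exact h i hi)
  exact this hf

lemma IsBlockwise.map_X_mem_supported (h : IsBlockwise bl Γ)
    {φ : MvPolynomial σ k →ₐ[k] MvPolynomial σ k} (hφ : φ ∈ Γ) {l : ℕ} {i : σ} (hi : bl i < l) :
    φ (X i) ∈ supported k {j | bl j < l} := by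
  have hX : (X i : MvPolynomial σ k) ∈ supported k {j | bl j < l} := by
    rw [supported_eq_adjoin_X]
    exact Algebra.subset_adjoin ⟨i, hi, rfl⟩
  obtain ⟨l', hl'⟩ := h φ hφ
  by_cases hil : bl i = l'
  · have h1 := (hl' i).2 hil
    have h2 : supported k {j | bl j < l'} ≤ supported k {j | bl j < l} :=
      supported_mono fun j (hj : bl j < l') => show bl j < l by omega
    simpa using add_mem (h2 h1) hX
  · rw [(hl' i).1 hil]
    exact hX

open scoped Classical in
/-- Regard a polynomial as a polynomial in the variables of block `l`, with coefficients in the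
polynomial ring. -/
noncomputable def expandBlock (bl : σ → ℕ) (l : ℕ) :
    MvPolynomial σ k →ₐ[k] MvPolynomial {i // bl i = l} (MvPolynomial σ k) :=
  aeval fun i => if h : bl i = l then X ⟨i, h⟩ else C (X i)

lemma expandBlock_eq_C {l : ℕ} {f : MvPolynomial σ k} (hf : f ∈ supported k {j | bl j < l}) :
    expandBlock bl l f = C f := by
  refine eq_of_mem_supported (G := (IsScalarTower.toAlgHom k (MvPolynomial σ k)
    (MvPolynomial {i // bl i = l} (MvPolynomial σ k)))) (fun i hi => ?_) hf
  have : bl i ≠ l := ne_of_lt hi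
  simp [expandBlock, this, algebraMap_eq]

lemma coeff_expandBlock_mem_supported {l : ℕ} {f : MvPolynomial σ k}
    (hf : f ∈ supported k {j | bl j < l + 1}) (d : {i // bl i = l} →₀ ℕ) :
    coeff d (expandBlock bl l f) ∈ supported k {j | bl j < l} := by
  have hmem : expandBlock bl l f ∈ (mapAlgHom (σ := {i // bl i = l})
      (supported k {j | bl j < l}).val).range := by
    rw [supported_eq_adjoin_X] at hf
    have : Algebra.adjoin k (X '' {j | bl j < l + 1}) ≤ (mapAlgHom (σ := {i // bl i = l})
        (supported k {j | bl j < l}).val).range.comap (expandBlock bl l) := by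
      refine Algebra.adjoin_le ?_
      rintro _ ⟨i, hi, rfl⟩
      by_cases hil : bl i = l
      · exact ⟨X ⟨i, hil⟩, by simp [expandBlock, hil]⟩
      · have hil' : bl i < l := lt_of_le_of_ne (Nat.lt_succ_iff.mp hi) hil
        have hX : (X i : MvPolynomial σ k) ∈ supported k {j | bl j < l} := by
          rw [supported_eq_adjoin_X]
          exact Algebra.subset_adjoin ⟨i, hil', rfl⟩
        exact ⟨C ⟨X i, hX⟩, by simp [expandBlock, hil]⟩
    exact this hf
  obtain ⟨P, hP⟩ := hmem
  rw [← hP]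
  simp only [AlgHom.toRingHom_eq_coe, RingHom.coe_coe, mapAlgHom_apply]
  rw [coeff_map]
  exact (coeff d P).2

/-- The coefficients of an invariant with respect to its top block of variables are invariant: a
member of `Γ` moving a lower block fixes the variables of the top block, and every other member
fixes the coefficients. -/
lemma coeff_expandBlock_mem_fixedSubalgebra (h : IsBlockwise bl Γ) {l : ℕ} {f : MvPolynomial σ k}
    (hf : f ∈ supported k {j | bl j < l + 1}) (hfΓ : f ∈ fixedSubalgebra Γ)
    (d : {i // bl i = l} →₀ ℕ) : coeff d (expandBlock bl l f) ∈ fixedSubalgebra Γ := by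
  intro φ hφ
  obtain ⟨l', hl'⟩ := h φ hφ
  by_cases hll' : l' < l
  · have hcomm : mapAlgHom φ (expandBlock bl l f) = expandBlock bl l (φ f) := by
      refine eq_of_mem_supported (F := (mapAlgHom φ).comp (expandBlock bl l))
        (G := (expandBlock bl l).comp φ) (fun i hi => ?_) hf
      by_cases hil : bl i = l
      · have : φ (X i) = X i := (hl' i).1 (by omega)
        simp [this, expandBlock, hil]
      · have hil' : bl i < l := lt_of_le_of_ne (Nat.lt_succ_iff.mp hi) hil
        rw [AlgHom.comp_apply, AlgHom.comp_apply,
          expandBlock_eq_C (h.map_X_mem_supported hφ hil')]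
        simp [expandBlock, hil]
    rw [hfΓ φ hφ] at hcomm
    conv_rhs => rw [← hcomm]
    exact (coeff_map (φ : MvPolynomial σ k →+* MvPolynomial σ k) _ d).symm
  · refine eq_of_mem_supported (G := AlgHom.id k _) (fun i hi => ?_)
      (coeff_expandBlock_mem_supported hf d)
    have hi' : bl i < l := hi
    exact (hl' i).1 (by omega)

lemma mem_adjoin_block (h : IsBlockwise bl Γ) {l : ℕ} {f : MvPolynomial σ k}
    (hf : f ∈ supported k {j | bl j < l + 1}) (hfΓ : f ∈ fixedSubalgebra Γ) :
    f ∈ Algebra.adjoin k (X '' {i | bl i = l} ∪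
      ((fixedSubalgebra Γ ⊓ supported k {j | bl j < l} :
      Subalgebra k (MvPolynomial σ k)) : Set (MvPolynomial σ k))) := by
  have hev : aeval (fun i : {i // bl i = l} => (X i.1 : MvPolynomial σ k)) (expandBlock bl l f)
      = f := by
    have : ((aeval (fun i : {i // bl i = l} => (X i.1 : MvPolynomial σ k))).restrictScalars k).comp
        (expandBlock bl l) = AlgHom.id k (MvPolynomial σ k) := by
      refine algHom_ext fun i => ?_
      by_cases hil : bl i = l <;> simp [expandBlock, hil]
    exact AlgHom.congr_fun this f
  have hsub := Algebra.subset_adjoin (R := k) (s := X '' {i | bl i = l} ∪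
    ((fixedSubalgebra Γ ⊓ supported k {j | bl j < l} :
      Subalgebra k (MvPolynomial σ k)) : Set (MvPolynomial σ k)))
  rw [← hev, aeval_def, eval₂_eq]
  refine sum_mem fun d _ => mul_mem (hsub (Or.inr ?_)) (prod_mem fun i _ => pow_mem
    (hsub (Or.inl ⟨i.1, i.2, rfl⟩)) _)
  exact ⟨coeff_expandBlock_mem_fixedSubalgebra h hf hfΓ d, coeff_expandBlock_mem_supported hf d⟩

/-- Two algebra homomorphisms agree on an invariant if they agree on its top block of variables and
on the invariants of the lower blocks. -/
lemma eq_of_eq_on_block (h : IsBlockwise bl Γ) {l : ℕ} {f : MvPolynomial σ k}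
    (hf : f ∈ supported k {j | bl j < l + 1}) (hfΓ : f ∈ fixedSubalgebra Γ)
    {B : Type*} [CommRing B] [Algebra k B] (F G : MvPolynomial σ k →ₐ[k] B)
    (h1 : ∀ i, bl i = l → F (X i) = G (X i))
    (h2 : ∀ u ∈ supported k {j | bl j < l}, u ∈ fixedSubalgebra Γ → F u = G u) : F f = G f := by
  have hle := Algebra.adjoin_le (S := AlgHom.equalizer F G) (s := X '' {i | bl i = l} ∪
    ((fixedSubalgebra Γ ⊓ supported k {j | bl j < l} :
      Subalgebra k (MvPolynomial σ k)) : Set (MvPolynomial σ k))) (by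
      rintro _ (⟨i, hi, rfl⟩ | ⟨hu1, hu2⟩)
      · exact h1 i hi
      · exact h2 _ hu2 hu1)
  exact hle (mem_adjoin_block h hf hfΓ)

open scoped Classical in
/-- Translation of the variables of block `l` by new variables. -/
noncomputable def translateBlock (bl : σ → ℕ) (l : ℕ) :
    MvPolynomial σ k →ₐ[k] MvPolynomial σ (MvPolynomial σ k) :=
  aeval fun i => C (X i) + if bl i = l then X i else 0

lemma translateBlock_eq_C {l : ℕ} {f : MvPolynomial σ k} (hf : f ∈ supported k {j | bl j < l}) :
    translateBlock bl l f = C f := by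
  refine eq_of_mem_supported (G := (IsScalarTower.toAlgHom k (MvPolynomial σ k)
    (MvPolynomial σ (MvPolynomial σ k)))) (fun i hi => ?_) hf
  have : bl i ≠ l := ne_of_lt hi
  simp [translateBlock, this, algebraMap_eq]

/-- Translations of the top block commute with `Γ`, so they have invariant coefficients on
invariants. -/
lemma coeff_translateBlock_mem_fixedSubalgebra (h : IsBlockwise bl Γ) {l : ℕ}
    {f : MvPolynomial σ k} (hf : f ∈ supported k {j | bl j < l + 1}) (hfΓ : f ∈ fixedSubalgebra Γ)
    (d : σ →₀ ℕ) : coeff d (translateBlock bl l f) ∈ fixedSubalgebra Γ := by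
  intro φ hφ
  obtain ⟨l', hl'⟩ := h φ hφ
  have hcomm : mapAlgHom φ (translateBlock bl l f) = translateBlock bl l (φ f) := by
    refine eq_of_mem_supported (F := (mapAlgHom φ).comp (translateBlock bl l))
      (G := (translateBlock bl l).comp φ) (fun i hi => ?_) hf
    by_cases hil : bl i = l
    · have hsub : φ (X i) - X i ∈ supported k {j | bl j < l} := by
        by_cases hll' : bl i = l'
        · have := (hl' i).2 hll'
          rwa [← hll', hil] at this
        · rw [(hl' i).1 hll', sub_self]
          exact zero_mem _
      have hT : translateBlock bl l (φ (X i)) =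
          translateBlock bl l (X i) + C (φ (X i) - X i) := by
        rw [← translateBlock_eq_C hsub, map_sub]
        ring
      rw [AlgHom.comp_apply, AlgHom.comp_apply, hT]
      simp [translateBlock, hil]
      ring
    · have hil' : bl i < l := lt_of_le_of_ne (Nat.lt_succ_iff.mp hi) hil
      rw [AlgHom.comp_apply, AlgHom.comp_apply,
        translateBlock_eq_C (h.map_X_mem_supported hφ hil')]
      simp [translateBlock, hil]
  rw [hfΓ φ hφ] at hcomm
  conv_rhs => rw [← hcomm]
  exact (coeff_map (φ : MvPolynomial σ k →+* MvPolynomial σ k) _ d).symm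

variable {Q : Type*} [CommRing Q] [Algebra k Q] (π : MvPolynomial σ k →ₐ[k] Q)

lemma map_eq_algebraMap_constantCoeff {A : Subalgebra k (MvPolynomial σ k)}
    (hπ : ∀ f ∈ hilbertIdeal A, π f = 0) {f : MvPolynomial σ k} (hf : f ∈ A) :
    π f = algebraMap k Q (constantCoeff f) := by
  have : f - C (constantCoeff f) ∈ hilbertIdeal A := by
    refine Ideal.subset_span ⟨sub_mem hf (A.algebraMap_mem _), by simp⟩
  have h := hπ _ this
  rw [map_sub, sub_eq_zero] at h
  rw [h]
  exact π.commutes _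

open scoped Classical in
/-- The part of a polynomial that involves only the variables of block `l`. -/
noncomputable def restrictBlock (bl : σ → ℕ) (l : ℕ) : MvPolynomial σ k →ₐ[k] MvPolynomial σ k :=
  aeval fun i => if bl i = l then X i else 0

/-- If `π` kills the Hilbert ideal, then it sends the coefficients of the translates of an
invariant `f` to their constant terms, so the translation acts on the image of `f` as on the value
of `f` where all lower blocks vanish. -/
lemma aevalTower_translateBlock (h : IsBlockwise bl Γ)
    (hπ : ∀ f ∈ hilbertIdeal (fixedSubalgebra Γ), π f = 0) {l : ℕ} {f : MvPolynomial σ k}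
    (hf : f ∈ supported k {j | bl j < l + 1}) (hfΓ : f ∈ fixedSubalgebra Γ) :
    aevalTower ((Algebra.TensorProduct.includeLeft : Q →ₐ[k] Q ⊗[k] Q).comp π)
      (fun i => 1 ⊗ₜ π (X i)) (translateBlock bl l f) = 1 ⊗ₜ π (restrictBlock bl l f) := by
  have hmap : MvPolynomial.map (constantCoeff (R := k)) (translateBlock bl l f) =
      restrictBlock bl l f := by
    have : (MvPolynomial.map (constantCoeff (R := k))).comp
        (translateBlock (k := k) bl l).toRingHom =
        (restrictBlock (k := k) bl l).toRingHom := by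
      refine ringHom_ext (fun a => ?_) fun i => ?_
      · simp [translateBlock, restrictBlock, MvPolynomial.algebraMap_apply]
      · by_cases hil : bl i = l <;> simp [translateBlock, restrictBlock, hil]
    exact RingHom.congr_fun this f
  have hright : ∀ g : MvPolynomial σ k, (1 : Q) ⊗ₜ[k] π g =
      eval₂ (algebraMap k (Q ⊗[k] Q)) (fun i => (1 : Q) ⊗ₜ[k] π (X i)) g := by
    intro g
    have : (Algebra.TensorProduct.includeRight : Q →ₐ[k] Q ⊗[k] Q).comp π =
        aeval fun i => (1 : Q) ⊗ₜ[k] π (X i) := algHom_ext fun i => by simp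
    exact AlgHom.congr_fun this g
  rw [← hmap, hright, eval₂_map]
  change eval₂ _ _ _ = _
  rw [eval₂_eq, eval₂_eq]
  refine Finset.sum_congr rfl fun d _ => ?_
  congr 1
  have hd := coeff_translateBlock_mem_fixedSubalgebra h hf hfΓ d
  simp [map_eq_algebraMap_constantCoeff π hπ hd]

/-- The coproduct modulo the Hilbert ideal is trivial on invariants. This goes up block by block:
an invariant `f` of the blocks up to `l` is a polynomial in the variables of block `l` and in
invariants of the lower blocks, which are constants modulo the Hilbert ideal; hence its coproduct
only translates block `l`, and its image is unchanged when the lower blocks are set to zero. -/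
lemma coproductMod_eq_algebraMap (h : IsBlockwise bl Γ)
    (hπ : ∀ f ∈ hilbertIdeal (fixedSubalgebra Γ), π f = 0) (l : ℕ) {f : MvPolynomial σ k}
    (hf : f ∈ supported k {j | bl j < l}) (hfΓ : f ∈ fixedSubalgebra Γ) :
    coproductMod π f = algebraMap k (Q ⊗[k] Q) (constantCoeff f) := by
  induction l generalizing f with
  | zero =>
    have hempty : {j | bl j < 0} = (∅ : Set σ) := by ext; simp
    rw [hempty, supported_empty] at hf
    obtain ⟨a, rfl⟩ := Algebra.mem_bot.mp hf
    rw [AlgHom.commutes, algebraMap_eq, constantCoeff_C]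
  | succ l ih =>
    have h1 : coproductMod π f = (aevalTower
        ((Algebra.TensorProduct.includeLeft : Q →ₐ[k] Q ⊗[k] Q).comp π)
        (fun i => 1 ⊗ₜ π (X i))).comp (translateBlock bl l) f := by
      refine eq_of_eq_on_block h hf hfΓ _ _ (fun i hi => ?_) fun u hu huΓ => ?_
      · simp [coproductMod_X, translateBlock, hi]
      · rw [ih hu huΓ, AlgHom.comp_apply, translateBlock_eq_C hu, aevalTower_C]
        simp [map_eq_algebraMap_constantCoeff π hπ huΓ]
    have h2 : (π.comp (restrictBlock bl l)) f = π f := by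
      refine eq_of_eq_on_block h hf hfΓ _ _ (fun i hi => by simp [restrictBlock, hi])
        fun u hu huΓ => ?_
      have h3 : restrictBlock bl l u =
          (Algebra.ofId k _).comp (aeval fun _ => (0 : k)) u := by
        refine eq_of_mem_supported (fun i hi => ?_) hu
        have : bl i ≠ l := ne_of_lt hi
        simp [restrictBlock, this]
      rw [map_eq_algebraMap_constantCoeff π hπ huΓ, AlgHom.comp_apply, h3, AlgHom.comp_apply,
        Algebra.ofId_apply, AlgHom.commutes]
      simp [constantCoeff, aeval_def]
    rw [h1, AlgHom.comp_apply, aevalTower_translateBlock π h hπ hf hfΓ, ← AlgHom.comp_apply, h2,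
      map_eq_algebraMap_constantCoeff π hπ hfΓ]
    exact ((Algebra.TensorProduct.includeRight : Q →ₐ[k] Q ⊗[k] Q).commutes _)

/-- The Hilbert ideal of a blockwise unitriangular set of endomorphisms is generated by at most as
many elements as there are variables. -/
theorem exists_generators_hilbertIdeal [Fintype σ] (h : IsBlockwise bl Γ) :
    ∃ g : σ → MvPolynomial σ k, Ideal.span (Set.range g) = hilbertIdeal (fixedSubalgebra Γ) := by
  set H := hilbertIdeal (fixedSubalgebra Γ)
  have hπ : ∀ f, Ideal.Quotient.mkₐ k H f = 0 ↔ f ∈ H := fun f => Ideal.Quotient.eq_zero_iff_mem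
  refine exists_generators_of_coideal (Ideal.Quotient.mkₐ k H) H (hilbertIdeal_ne_top _)
    (fun f => (hπ f).mp) fun f hf => ?_
  have hle : H ≤ RingHom.ker (coproductMod (Ideal.Quotient.mkₐ k H)).toRingHom := by
    refine Ideal.span_le.mpr fun f hf => ?_
    have hsupp : f ∈ supported k {j | bl j < Finset.univ.sup bl + 1} := by
      have : {j | bl j < Finset.univ.sup bl + 1} = Set.univ :=
        Set.eq_univ_of_forall fun j => Nat.lt_succ_iff.mpr (Finset.le_sup (Finset.mem_univ j))
      rw [this, supported_univ]
      exact Algebra.mem_top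
    have := coproductMod_eq_algebraMap (Ideal.Quotient.mkₐ k H) h (fun f => (hπ f).mpr) _ hsupp hf.1
    rw [hf.2, map_zero] at this
    exact this
  exact hle hf

end HilbertIdeal

/-! ### Generators of a graded direct summand -/

section Retraction

variable {σ k : Type*} [Field k]

lemma homogeneousComponent_mul_of_isHomogeneous {a : MvPolynomial σ k} {e : ℕ}
    (ha : a.IsHomogeneous e) (d : ℕ) (g : MvPolynomial σ k) :
    homogeneousComponent (d + e) (g * a) = homogeneousComponent d g * a := by
  conv_lhs => rw [← sum_homogeneousComponent g, Finset.sum_mul, map_sum]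
  have hterm : ∀ i, homogeneousComponent (d + e) (homogeneousComponent i g * a) =
      if i = d then homogeneousComponent d g * a else 0 := by
    intro i
    have := homogeneousComponent_of_mem (m := d + e) (n := i + e)
      (((homogeneousComponent_isHomogeneous i g).mul ha))
    rw [this]
    by_cases hi : i = d
    · simp [hi]
    · rw [if_neg hi, if_neg (by omega)]
  rw [Finset.sum_congr rfl fun i _ => hterm i, Finset.sum_ite_eq']
  split_ifs with h
  · rfl
  · rw [homogeneousComponent_eq_zero _ _ (by simpa [Nat.lt_succ_iff] using h), zero_mul]

/-- The homogeneous elements of positive degree of a subalgebra. -/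
def positiveHomogeneous (A : Subalgebra k (MvPolynomial σ k)) : Set (MvPolynomial σ k) :=
  {a | a ∈ A ∧ ∃ e, 0 < e ∧ a.IsHomogeneous e}

variable {A : Subalgebra k (MvPolynomial σ k)}

lemma positiveHomogeneous_subset_hilbertIdeal :
    positiveHomogeneous A ⊆ hilbertIdeal A := by
  rintro a ⟨ha, e, he, hae⟩
  refine Ideal.subset_span ⟨ha, ?_⟩
  by_contra h
  have := hae (d := 0) (by simpa [constantCoeff] using h)
  simp at this
  omega

lemma eq_sum_positive {f : MvPolynomial σ k} (hf : constantCoeff f = 0) :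
    f = ∑ i ∈ Finset.range f.totalDegree, homogeneousComponent (i + 1) f := by
  conv_lhs => rw [← sum_homogeneousComponent f, Finset.sum_range_succ']
  rw [homogeneousComponent_zero, show coeff 0 f = 0 from hf, C_0, add_zero]

/-- The product of the maximal homogeneous ideal with the Hilbert ideal of a graded subalgebra `A`
is spanned, as a vector space, by products `x * a` of homogeneous elements of positive degree with
`a ∈ A`. -/
lemma mul_hilbertIdeal_subset_span (hgr : ∀ f ∈ A, ∀ d, homogeneousComponent d f ∈ A)
    {z : MvPolynomial σ k}
    (hz : z ∈ RingHom.ker (constantCoeff (R := k) (σ := σ)) * hilbertIdeal A) :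
    z ∈ Submodule.span k {y | ∃ x a d e, 0 < d ∧ 0 < e ∧ IsHomogeneous x d ∧ a ∈ A ∧
      IsHomogeneous a e ∧ y = x * a} := by
  refine Submodule.mul_induction_on hz (fun s hs t ht => ?_) fun x y hx hy => add_mem hx hy
  replace hs : constantCoeff s = 0 := hs
  induction ht using Submodule.span_induction generalizing s with
  | zero => rw [mul_zero]; exact zero_mem _
  | add x y _ _ hx hy => rw [mul_add]; exact add_mem (hx s hs) (hy s hs)
  | smul c x _ hx =>
    rw [smul_eq_mul, ← mul_assoc]
    exact hx _ (by rw [map_mul, hs, zero_mul])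
  | mem g hg =>
    rw [eq_sum_positive hs, eq_sum_positive hg.2, Finset.sum_mul_sum]
    refine sum_mem fun i _ => sum_mem fun j _ => Submodule.subset_span ?_
    exact ⟨_, _, i + 1, j + 1, i.succ_pos, j.succ_pos, homogeneousComponent_isHomogeneous _ _,
      hgr _ hg.1 _, homogeneousComponent_isHomogeneous _ _, rfl⟩

/-- Elements of `A` that generate the Hilbert ideal modulo its product with the maximal homogeneous
ideal generate the algebra `A`, if `A` is a direct summand. By induction on the degree: an element
`b` of `A` is a combination of the given ones plus terms `x * a`, and the retraction `R` onto `A`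
replaces the factor `x` of lower degree by an element of `A`. -/
lemma isHomogeneous_mem_adjoin (hgr : ∀ f ∈ A, ∀ d, homogeneousComponent d f ∈ A)
    (R : MvPolynomial σ k →ₗ[k] MvPolynomial σ k) (hRA : ∀ s, R s ∈ A)
    (hR : ∀ s, ∀ a ∈ A, R (s * a) = R s * a) (hRid : ∀ a ∈ A, R a = a)
    {ι : Type*} [Fintype ι] {a : ι → MvPolynomial σ k} (ha : ∀ i, a i ∈ positiveHomogeneous A)
    (hspan : ∀ b ∈ positiveHomogeneous A, ∃ c : ι → k, b - ∑ i, c i • a i ∈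
      RingHom.ker (constantCoeff (R := k) (σ := σ)) * hilbertIdeal A)
    (e : ℕ) {b : MvPolynomial σ k} (hb : b ∈ A) (hbe : b.IsHomogeneous e) :
    b ∈ Algebra.adjoin k (Set.range a) := by
  induction e using Nat.strong_induction_on generalizing b with
  | _ e ih =>
    rcases Nat.eq_zero_or_pos e with rfl | he
    · rw [← homogeneousComponent_eq_self hbe, homogeneousComponent_zero]
      exact Subalgebra.algebraMap_mem _ _
    obtain ⟨c, hc⟩ := hspan b ⟨hb, e, he, hbe⟩
    -- `T` fixes `b`, and it maps both kinds of terms in the expression of `b` into the algebra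
    -- generated by the `a i`.
    set T : MvPolynomial σ k →ₗ[k] MvPolynomial σ k :=
      homogeneousComponent e ∘ₗ R ∘ₗ homogeneousComponent e with hT
    have hTb : T b = b := by
      simp only [hT, LinearMap.comp_apply]
      rw [homogeneousComponent_eq_self hbe, hRid b hb, homogeneousComponent_eq_self hbe]
    have hTa : ∀ i, T (a i) ∈ Algebra.adjoin k (Set.range a) := by
      intro i
      obtain ⟨hiA, d, -, hd⟩ := ha i
      simp only [hT, LinearMap.comp_apply]
      rw [homogeneousComponent_of_mem hd]
      split_ifs with h
      · rw [hRid _ hiA, homogeneousComponent_eq_self (h ▸ hd)]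
        exact Algebra.subset_adjoin ⟨i, rfl⟩
      · simp
    have hTz : ∀ z ∈ RingHom.ker (constantCoeff (R := k) (σ := σ)) * hilbertIdeal A,
        T z ∈ Algebra.adjoin k (Set.range a) := by
      intro z hz
      have hle : Submodule.span k {y | ∃ x a d e, 0 < d ∧ 0 < e ∧ IsHomogeneous x d ∧ a ∈ A ∧
          IsHomogeneous a e ∧ y = x * a} ≤
          (Subalgebra.toSubmodule (Algebra.adjoin k (Set.range a))).comap T := by
        refine Submodule.span_le.mpr ?_
        rintro _ ⟨x, y, d, d', hd, hd', hx, hyA, hy, rfl⟩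
        change T (x * y) ∈ Algebra.adjoin k (Set.range a)
        simp only [hT, LinearMap.comp_apply]
        rw [homogeneousComponent_of_mem (hx.mul hy)]
        split_ifs with h
        · rw [hR x y hyA, h, homogeneousComponent_mul_of_isHomogeneous hy]
          exact mul_mem (ih d (by omega) (hgr _ (hRA x) d) (homogeneousComponent_isHomogeneous _ _))
            (ih d' (by omega) hyA hy)
        · simp
      exact hle (mul_hilbertIdeal_subset_span hgr hz)
    have hsum : b = T (b - ∑ i, c i • a i) + ∑ i, c i • T (a i) := by
      rw [map_sub, map_sum, hTb]
      simp
    rw [hsum]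
    exact add_mem (hTz _ hc) (sum_mem fun i _ => Subalgebra.smul_mem _ (hTa i) _)

/-- If the Hilbert ideal of a graded direct summand `A` of the polynomial ring is generated by as
many elements as there are variables, then so is the algebra `A`. -/
theorem exists_algebra_generators [Fintype σ] (hgr : ∀ f ∈ A, ∀ d, homogeneousComponent d f ∈ A)
    (R : MvPolynomial σ k →ₗ[k] MvPolynomial σ k) (hRA : ∀ s, R s ∈ A)
    (hR : ∀ s, ∀ a ∈ A, R (s * a) = R s * a) (hRid : ∀ a ∈ A, R a = a)
    {g : σ → MvPolynomial σ k} (hg : Ideal.span (Set.range g) = hilbertIdeal A) :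
    ∃ d ≤ Fintype.card σ, ∃ a : Fin d → MvPolynomial σ k,
      Algebra.adjoin k (Set.range a) = A := by
  set N : Ideal (MvPolynomial σ k) :=
    RingHom.ker (constantCoeff (R := k) (σ := σ)) * hilbertIdeal A
  set mk : MvPolynomial σ k →ₗ[k] MvPolynomial σ k ⧸ N.restrictScalars k :=
    (N.restrictScalars k).mkQ with hmk
  have hmk0 : ∀ f, mk f = 0 ↔ f ∈ N := fun f => Submodule.Quotient.mk_eq_zero _
  have hle : Submodule.span k (mk '' positiveHomogeneous A) ≤
      Submodule.span k (Set.range (mk ∘ g)) := by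
    refine Submodule.span_le.mpr ?_
    rintro _ ⟨a, ha, rfl⟩
    have haH := positiveHomogeneous_subset_hilbertIdeal ha
    rw [SetLike.mem_coe, ← hg] at haH
    obtain ⟨c, hc⟩ := Submodule.mem_span_range_iff_exists_fun _ |>.mp haH
    rw [← hc, map_sum]
    refine sum_mem fun i _ => ?_
    have hi : mk (c i • g i) = constantCoeff (c i) • mk (g i) := by
      rw [← map_smul, ← sub_eq_zero, ← map_sub, hmk0, smul_eq_C_mul, smul_eq_mul, ← sub_mul]
      refine Ideal.mul_mem_mul ?_ (hg ▸ Ideal.subset_span ⟨i, rfl⟩)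
      simp [RingHom.mem_ker]
    rw [hi]
    exact Submodule.smul_mem _ _ (Submodule.subset_span ⟨i, rfl⟩)
  have hfin : Module.finrank k (Submodule.span k (mk '' positiveHomogeneous A)) ≤
      Fintype.card σ := by
    have := FiniteDimensional.span_of_finite k (Set.finite_range (mk ∘ g))
    exact (Submodule.finrank_mono hle).trans (finrank_range_le_card _)
  have : Module.Finite k (Submodule.span k (mk '' positiveHomogeneous A)) := by
    have := FiniteDimensional.span_of_finite k (Set.finite_range (mk ∘ g))
    exact Submodule.finiteDimensional_of_le hle
  obtain ⟨w, hw, hwspan, -⟩ := Submodule.exists_fun_fin_finrank_span_eq k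
    (mk '' positiveHomogeneous A)
  choose a ha haw using hw
  refine ⟨_, hfin, a, le_antisymm ?_ fun b hb => ?_⟩
  · refine Algebra.adjoin_le ?_
    rintro _ ⟨i, rfl⟩
    exact (ha i).1
  · rw [← sum_homogeneousComponent b]
    refine sum_mem fun e _ => isHomogeneous_mem_adjoin hgr R hRA hR hRid ha (fun b hb => ?_) e
      (hgr b hb e) (homogeneousComponent_isHomogeneous e b)
    have hbspan : mk b ∈ Submodule.span k (Set.range w) :=
      hwspan.ge (Submodule.subset_span ⟨b, hb, rfl⟩)
    obtain ⟨c, hc⟩ := Submodule.mem_span_range_iff_exists_fun _ |>.mp hbspan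
    refine ⟨c, (hmk0 _).mp ?_⟩
    rw [map_sub, map_sum, ← hc, sub_eq_zero]
    exact Finset.sum_congr rfl fun i _ => by rw [map_smul, haw]

/-- A subalgebra over which the polynomial ring is algebraic is itself a polynomial ring, if it has
no more generators than there are variables: they form a transcendence basis. -/
theorem nonempty_algEquiv_of_generators [Fintype σ] [Algebra.IsAlgebraic A (MvPolynomial σ k)]
    {d : ℕ} (hd : d ≤ Fintype.card σ) {a : Fin d → MvPolynomial σ k}
    (ha : Algebra.adjoin k (Set.range a) = A) : Nonempty (MvPolynomial σ k ≃ₐ[k] A) := by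
  subst ha
  obtain ⟨t, hta, ht⟩ := exists_isTranscendenceBasis_subset (R := k) (Set.range a)
  have hcard : t.ncard = Fintype.card σ := by
    have h := ht.lift_cardinalMk_eq (IsTranscendenceBasis.mvPolynomial σ k)
    have := congrArg Cardinal.toNat h
    rw [← Nat.card_coe_set_eq, Nat.card]
    simpa using this
  have hrange : (Set.range a).ncard ≤ d := by
    rw [← Set.image_univ]
    exact (Set.ncard_image_le Set.finite_univ).trans (by simp)
  have hta' : t = Set.range a :=
    Set.eq_of_subset_of_ncard_le hta (by omega) (Set.finite_range a)
  have hdσ : d = Fintype.card σ := le_antisymm hd (by rw [← hcard, hta']; exact hrange)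
  have hinj : Function.Injective a := by
    rw [← Set.injOn_univ]
    refine Set.injOn_of_ncard_image_eq ?_ Set.finite_univ
    rw [Set.image_univ, ← hta', hcard]
    simp [hdσ]
  have hind : AlgebraicIndependent k a := by
    rw [← algebraicIndependent_subtype_range hinj, ← hta']
    exact ht.1
  exact ⟨(renameEquiv k (Fintype.equivFinOfCardEq hdσ.symm)).trans hind.aevalEquiv⟩

end Retraction

/-! ### The linear action in coordinates -/

section Action

open Module

variable {k : Type*} [Field k] {V : Type*} [AddCommGroup V] [Module k V]

lemma symAct_ι (g : LinearMap.GeneralLinearGroup k V) (x : Dual k V) :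
    symAct g (SymmetricAlgebra.ι k (Dual k V) x) =
      SymmetricAlgebra.ι k (Dual k V) (dualAct g x) :=
  SymmetricAlgebra.lift_ι_apply _ _

lemma symAct_one (f : SymmetricAlgebra k (Dual k V)) :
    symAct (1 : LinearMap.GeneralLinearGroup k V) f = f := by
  have : symAct (1 : LinearMap.GeneralLinearGroup k V) =
      AlgHom.id k (SymmetricAlgebra k (Dual k V)) := by
    refine SymmetricAlgebra.algHom_ext (LinearMap.ext fun x => ?_)
    change symAct 1 (SymmetricAlgebra.ι k (Dual k V) x) = SymmetricAlgebra.ι k (Dual k V) x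
    rw [symAct_ι]
    congr 1
  rw [this, AlgHom.id_apply]

lemma symAct_mul (g h : LinearMap.GeneralLinearGroup k V) (f : SymmetricAlgebra k (Dual k V)) :
    symAct (g * h) f = symAct g (symAct h f) := by
  have : symAct (g * h) = (symAct g).comp (symAct h) := by
    refine SymmetricAlgebra.algHom_ext (LinearMap.ext fun x => ?_)
    change symAct (g * h) (SymmetricAlgebra.ι k (Dual k V) x) =
      symAct g (symAct h (SymmetricAlgebra.ι k (Dual k V) x))
    simp only [symAct_ι]
    congr 1
  rw [this, AlgHom.comp_apply]

lemma symAct_inv_eq {g : LinearMap.GeneralLinearGroup k V} {f : SymmetricAlgebra k (Dual k V)}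
    (h : symAct g f = f) : symAct g⁻¹ f = f := by
  conv_lhs => rw [← h]
  rw [← symAct_mul, inv_mul_cancel, symAct_one]

/-- The elements of `GL(V)` that fix a given element of `Sym V^*`. -/
def symStabilizer (f : SymmetricAlgebra k (Dual k V)) :
    Subgroup (LinearMap.GeneralLinearGroup k V) where
  carrier := {g | symAct g f = f}
  mul_mem' {g h} hg hh := by
    change symAct (g * h) f = f
    rw [symAct_mul, show symAct h f = f from hh, show symAct g f = f from hg]
  one_mem' := symAct_one f
  inv_mem' hg := symAct_inv_eq hg

/-- The action of `g` on `Sym V^*`, written in the coordinates given by a basis of `V^*`. -/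
noncomputable def mvAct {n : ℕ} (b : Basis (Fin n) k (Dual k V))
    (g : LinearMap.GeneralLinearGroup k V) :
    MvPolynomial (Fin n) k →ₐ[k] MvPolynomial (Fin n) k :=
  ((SymmetricAlgebra.equivMvPolynomial b : _ →ₐ[k] MvPolynomial (Fin n) k).comp (symAct g)).comp
    (SymmetricAlgebra.equivMvPolynomial b).symm

variable {n : ℕ} (b : Basis (Fin n) k (Dual k V))

lemma mvAct_apply (g : LinearMap.GeneralLinearGroup k V) (f : MvPolynomial (Fin n) k) :
    mvAct b g f = SymmetricAlgebra.equivMvPolynomial b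
      (symAct g ((SymmetricAlgebra.equivMvPolynomial b).symm f)) := rfl

lemma mvAct_eq_iff (g : LinearMap.GeneralLinearGroup k V) (f : MvPolynomial (Fin n) k) :
    mvAct b g f = f ↔ symAct g ((SymmetricAlgebra.equivMvPolynomial b).symm f) =
      (SymmetricAlgebra.equivMvPolynomial b).symm f := by
  rw [mvAct_apply, AlgEquiv.eq_symm_apply]

lemma equivMvPolynomial_ι (x : Dual k V) :
    SymmetricAlgebra.equivMvPolynomial b (SymmetricAlgebra.ι k (Dual k V) x) =
      ∑ j, b.repr x j • X j := by
  conv_lhs => rw [← b.sum_repr x]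
  simp only [map_sum, map_smul, SymmetricAlgebra.equivMvPolynomial_ι_apply]

lemma mvAct_X (g : LinearMap.GeneralLinearGroup k V) (i : Fin n) :
    mvAct b g (X i) = ∑ j, b.repr (dualAct g (b i)) j • X j := by
  rw [mvAct_apply, SymmetricAlgebra.equivMvPolynomial_symm_X, symAct_ι, equivMvPolynomial_ι]

lemma isHomogeneous_mvAct (g : LinearMap.GeneralLinearGroup k V) {f : MvPolynomial (Fin n) k}
    {d : ℕ} (hf : f.IsHomogeneous d) : (mvAct b g f).IsHomogeneous d := by
  have h : mvAct b g = aeval fun i => mvAct b g (X i) := algHom_ext fun i => by simp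
  rw [h, ← one_mul d]
  refine hf.aeval _ fun i => ?_
  rw [mvAct_X]
  refine IsHomogeneous.sum _ _ _ fun j _ => ?_
  rw [smul_eq_C_mul]
  simpa using (isHomogeneous_C (Fin n) _).mul (isHomogeneous_X k j)

lemma homogeneousComponent_mvAct (g : LinearMap.GeneralLinearGroup k V)
    (f : MvPolynomial (Fin n) k) (d : ℕ) :
    homogeneousComponent d (mvAct b g f) = mvAct b g (homogeneousComponent d f) := by
  conv_lhs => rw [← sum_homogeneousComponent f, map_sum, map_sum]
  have hterm : ∀ i, homogeneousComponent d (mvAct b g (homogeneousComponent i f)) =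
      if i = d then mvAct b g (homogeneousComponent d f) else 0 := by
    intro i
    rw [homogeneousComponent_of_mem
      (isHomogeneous_mvAct b g (homogeneousComponent_isHomogeneous i f))]
    by_cases hi : i = d
    · simp [hi]
    · rw [if_neg hi, if_neg (Ne.symm hi)]
  rw [Finset.sum_congr rfl fun i _ => hterm i, Finset.sum_ite_eq']
  split_ifs with h
  · rfl
  · rw [homogeneousComponent_eq_zero _ _ (by simpa [Nat.lt_succ_iff] using h), map_zero]

/-- The ring of invariants in coordinates. -/
noncomputable def mvInvariants (G : Subgroup (LinearMap.GeneralLinearGroup k V)) :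
    Subalgebra k (MvPolynomial (Fin n) k) :=
  (invariants G).map (SymmetricAlgebra.equivMvPolynomial b : _ →ₐ[k] MvPolynomial (Fin n) k)

lemma mem_mvInvariants {G : Subgroup (LinearMap.GeneralLinearGroup k V)}
    {f : MvPolynomial (Fin n) k} : f ∈ mvInvariants b G ↔ ∀ g ∈ G, mvAct b g f = f := by
  simp only [mvAct_eq_iff]
  constructor
  · rintro ⟨f, hf, rfl⟩ g hg
    simpa using hf g hg
  · intro h
    exact ⟨(SymmetricAlgebra.equivMvPolynomial b).symm f, h, by simp⟩

lemma isIntegral_mvInvariants (G : Subgroup (LinearMap.GeneralLinearGroup k V)) [Finite G] :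
    Algebra.IsIntegral (mvInvariants b G) (MvPolynomial (Fin n) k) := by
  let _ : MulSemiringAction G (MvPolynomial (Fin n) k) :=
    { smul := fun g f => mvAct b g f
      one_smul := fun f => (mvAct_eq_iff b 1 f).mpr (symAct_one _)
      mul_smul := fun g h f => by
        change mvAct b (g * h) f = mvAct b g (mvAct b h f)
        simp [mvAct_apply, symAct_mul]
      smul_zero := fun g => map_zero (mvAct b g)
      smul_add := fun g => map_add (mvAct b g)
      smul_one := fun g => map_one (mvAct b g)
      smul_mul := fun g => map_mul (mvAct b g) }
  have : Algebra.IsInvariant (mvInvariants b G) (MvPolynomial (Fin n) k) G :=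
    ⟨fun f hf => ⟨⟨f, (mem_mvInvariants b).mpr fun g hg => hf ⟨g, hg⟩⟩, rfl⟩⟩
  exact Algebra.IsInvariant.isIntegral _ _ G

/-- A direct summand of `Sym V^*` has a retraction onto it, here transported to coordinates. -/
lemma exists_retraction {G : Subgroup (LinearMap.GeneralLinearGroup k V)}
    (hS : IsDirectSummand (invariants G)) :
    ∃ R : MvPolynomial (Fin n) k →ₗ[k] MvPolynomial (Fin n) k, (∀ s, R s ∈ mvInvariants b G) ∧
      (∀ s, ∀ a ∈ mvInvariants b G, R (s * a) = R s * a) ∧ ∀ a ∈ mvInvariants b G, R a = a := by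
  obtain ⟨N, hN⟩ := hS
  set e := SymmetricAlgebra.equivMvPolynomial b
  set P := Submodule.projection _ N hN
  refine ⟨e.toLinearMap ∘ₗ P.restrictScalars k ∘ₗ e.symm.toLinearMap, fun s => ?_, ?_, ?_⟩
  · obtain ⟨y, hy⟩ := Submodule.projection_apply_mem hN (e.symm s)
    exact ⟨_, y.2, congrArg e hy⟩
  · rintro s _ ⟨a, ha, rfl⟩
    have h1 : e.symm s * a = (⟨a, ha⟩ : invariants G) • e.symm s := by
      rw [mul_comm]; rfl
    have h2 : P (e.symm s * a) = P (e.symm s) * a := by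
      rw [h1, map_smul, mul_comm]; rfl
    change e (P (e.symm (s * e a))) = e (P (e.symm s)) * e a
    rw [map_mul, e.symm_apply_apply, h2, map_mul]
  · rintro _ ⟨a, ha, rfl⟩
    have : P a = a := Submodule.projection_apply_of_mem_left hN ⟨⟨a, ha⟩, rfl⟩
    change e (P (e.symm (e a))) = e a
    rw [e.symm_apply_apply, this]

end Action

/-! ### Generalised Nakajima groups act blockwise -/

section Blocks

open Module

variable {k : Type*} [Field k] {V : Type*} [AddCommGroup V] [Module k V] {n : ℕ}
  (b : Basis (Fin n) k (Dual k V))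

lemma le_beta {g : LinearMap.GeneralLinearGroup k V} {i j : Fin n}
    (h : b.repr (dualAct g (b i) - b i) j ≠ 0) : (j : ℕ) + 1 ≤ beta b g := by
  classical
  exact Finset.le_sup (f := fun j : Fin n => (j : ℕ) + 1)
    (Finset.mem_filter.mpr ⟨Finset.mem_univ j, i, h⟩)

/-- The invariants of a generalised Nakajima group are those of a blockwise set of endomorphisms:
the generators of the subgroups `blockSubgroup`, where the block of a variable is the number of
`s t` before it. -/
lemma exists_isBlockwise {G : Subgroup (LinearMap.GeneralLinearGroup k V)} {r : ℕ}
    {s : Fin (r + 1) → ℕ} (hs : StrictMono s)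
    (hG : Subgroup.closure
      (⋃ t : Fin r, (blockSubgroup G b (s t.castSucc) (s t.succ) :
        Set (LinearMap.GeneralLinearGroup k V))) = G) :
    ∃ (bl : Fin n → ℕ) (Γ : Set (MvPolynomial (Fin n) k →ₐ[k] MvPolynomial (Fin n) k)),
      IsBlockwise bl Γ ∧ fixedSubalgebra Γ = mvInvariants b G := by
  classical
  set P : Fin r → Set (LinearMap.GeneralLinearGroup k V) := fun t =>
    {g | g ∈ G ∧ ∀ i : Fin n, dualAct g (b i) ≠ b i →
      (s t.castSucc < (i : ℕ) + 1 ∧ (i : ℕ) + 1 ≤ s t.succ) ∧ beta b g ≤ s t.castSucc}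
  refine ⟨fun i => (Finset.univ.filter fun u => s u ≤ (i : ℕ)).card,
    {φ | ∃ t, ∃ g ∈ P t, φ = mvAct b g}, ?_, ?_⟩
  · rintro _ ⟨t, g, hg, rfl⟩
    have hfix : ∀ i, dualAct g (b i) = b i → mvAct b g (X i) = X i := by
      intro i hi
      rw [mvAct_X, hi, ← equivMvPolynomial_ι, SymmetricAlgebra.equivMvPolynomial_ι_apply]
    refine ⟨t + 1, fun i => ⟨fun hi => ?_, fun hi => ?_⟩⟩
    · by_contra hne
      obtain ⟨⟨h1, h2⟩, -⟩ := hg.2 i fun h => hne (hfix i h)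
      apply hi
      have : (Finset.univ.filter fun u => s u ≤ (i : ℕ)) = Finset.Iic t.castSucc := by
        ext u
        simp only [Finset.mem_filter, Finset.mem_univ, true_and, Finset.mem_Iic]
        constructor
        · intro hu
          by_contra hlt
          have hle : t.succ ≤ u := Fin.castSucc_lt_iff_succ_le.mp (not_le.mp hlt)
          have := hs.monotone hle
          omega
        · intro hu
          have := hs.monotone hu
          omega
      exact (congrArg Finset.card this).trans (Fin.card_Iic _)
    · by_cases hgi : dualAct g (b i) = b i
      · rw [hfix i hgi, sub_self]
        exact zero_mem _
      · have hβ := (hg.2 i hgi).2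
        have hX : mvAct b g (X i) - X i = ∑ j, b.repr (dualAct g (b i) - b i) j • X j := by
          rw [← equivMvPolynomial_ι, map_sub, map_sub, mvAct_X, ← equivMvPolynomial_ι,
            SymmetricAlgebra.equivMvPolynomial_ι_apply]
        rw [hX]
        refine sum_mem fun j _ => ?_
        by_cases hj : b.repr (dualAct g (b i) - b i) j = 0
        · rw [hj, zero_smul]
          exact zero_mem _
        · refine Subalgebra.smul_mem _ ?_ _
          rw [supported_eq_adjoin_X]
          refine Algebra.subset_adjoin ⟨j, ?_, rfl⟩
          have hj' := le_beta b hj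
          have hsub : (Finset.univ.filter fun u => s u ≤ (j : ℕ)) ⊆ Finset.Iio t.castSucc := by
            intro u hu
            rw [Finset.mem_Iio]
            refine hs.lt_iff_lt.mp ?_
            have := (Finset.mem_filter.mp hu).2
            omega
          have := Finset.card_le_card hsub
          rw [Fin.card_Iio] at this
          exact Nat.lt_succ_iff.mpr this
  · ext f
    rw [mem_mvInvariants]
    constructor
    · intro hf g hg
      rw [mvAct_eq_iff]
      have hle : G ≤ symStabilizer ((SymmetricAlgebra.equivMvPolynomial b).symm f) := by
        rw [← hG, Subgroup.closure_le]
        refine Set.iUnion_subset fun t => ?_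
        change Subgroup.closure (P t) ≤ _
        rw [Subgroup.closure_le]
        exact fun g hg => (mvAct_eq_iff b g f).mp (hf _ ⟨t, g, hg, rfl⟩)
      exact hle hg
    · rintro hf _ ⟨t, g, hg, rfl⟩
      exact hf g hg.1

end Blocks

end GenNakajima

theorem mainTheorem2 {k : Type*} [Field k] {p : ℕ} [Fact p.Prime] [CharP k p]
    {V : Type*} [AddCommGroup V] [Module k V] [FiniteDimensional k V]
    (G : Subgroup (LinearMap.GeneralLinearGroup k V)) [Finite G] (hp : IsPGroup p G)
    (hG : GenNakajima.IsGenNakajima G)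
    (hS : GenNakajima.IsDirectSummand (GenNakajima.invariants G)) :
    Nonempty (MvPolynomial (Fin (Module.finrank k V)) k ≃ₐ[k] GenNakajima.invariants G) := by
  obtain ⟨n, b, r, s, -, -, hs, -, -, hgen⟩ := hG
  have hn : Module.finrank k V = n := by
    rw [← Subspace.dual_finrank_eq, Module.finrank_eq_card_basis b, Fintype.card_fin]
  obtain ⟨bl, Γ, hΓ, hA⟩ := GenNakajima.exists_isBlockwise b hs hgen
  obtain ⟨h, hh⟩ := GenNakajima.exists_generators_hilbertIdeal hΓ
  rw [hA] at hh
  have hgr : ∀ f ∈ GenNakajima.mvInvariants b G, ∀ d,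
      MvPolynomial.homogeneousComponent d f ∈ GenNakajima.mvInvariants b G := by
    intro f hf d
    rw [GenNakajima.mem_mvInvariants] at hf ⊢
    intro g hg
    rw [← GenNakajima.homogeneousComponent_mvAct, hf g hg]
  obtain ⟨R, hRA, hR, hRid⟩ := GenNakajima.exists_retraction b hS
  obtain ⟨d, hd, a, ha⟩ := GenNakajima.exists_algebra_generators hgr R hRA hR hRid hh
  have := GenNakajima.isIntegral_mvInvariants b G
  obtain ⟨E⟩ := GenNakajima.nonempty_algEquiv_of_generators hd ha
  exact ⟨((MvPolynomial.renameEquiv k (finCongr hn)).trans E).trans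
    ((SymmetricAlgebra.equivMvPolynomial b).subalgebraMap (GenNakajima.invariants G)).symm⟩
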